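/- All Hilbert spaces are finite-dimensional, complex and nonzero. A density matrix is a positive semidefinite matrix of trace $1$; a channel is a completely positive trace-preserving linear map between full matrix algebras. For $p\ge 1$ put $\|A\|_p=(\operatorname{Tr}|A|^p)^{1/p}$ with $|A|=(A^*A)^{1/2}$, and for a linear map $\Omega$ between matrix algebras put $\nu_p(\Omega)=\sup_\rho\|\Omega(\rho)\|_p$, the supremum being over all density matrices $\rho$ in the domain of $\Omega$. Theorem. Let $\Phi$ be an entanglement-breaking channel in Holevo form, that is, $\Phi(\rho)=\sum_{k=1}^K R_k\operatorname{Tr}(X_k\rho)$ for some $K$, some density matrices $R_k$ and some POVM $\{X_k\}$ (i.e. $X_k\ge 0$ and $\sum_k X_k=I$), and let $\Omega$ be an arbitrary channel. Then for every real $p\ge 1$, $$\nu_p(\Phi\otimes\Omega)=\nu_p(\Phi)\,\nu_p(\Omega).$$ Moreover, the supremum defining $\nu_p(\Phi\otimes\Omega)$ is attained at a product input: there are density matrices $\rho$ and $\sigma$ such that $\|(\Phi\otimes\Omega)(\tau)\|_p\le\|(\Phi\otimes\Omega)(\rho\otimes\sigma)\|_p$ for all density matrices $\tau$ on the product space. 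-/

import Mathlib

open scoped Matrix Kronecker MatrixOrder ComplexOrder

noncomputable section

namespace QChannel

/-- A density matrix: positive semidefinite with unit trace. -/
structure IsDensity {m : Type*} [Fintype m] (ρ : Matrix m m ℂ) : Prop where
  posSemidef : ρ.PosSemidef
  trace_eq_one : ρ.trace = 1

/-- The tensor product `Φ ⊗ Ω` of two linear maps on matrix algebras, acting on matrices
indexed by the product type. It is the linear map with
`(Φ ⊗ Ω) (A ⊗ₖ B) = Φ A ⊗ₖ Ω B` (see `tensorMap_kronecker`). -/
def tensorMap {m n m' n' : Type*} [Fintype m] [DecidableEq m] [Fintype m'] [DecidableEq m']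
    (Φ : Matrix m m ℂ →ₗ[ℂ] Matrix n n ℂ) (Ω : Matrix m' m' ℂ →ₗ[ℂ] Matrix n' n' ℂ) :
    Matrix (m × m') (m × m') ℂ →ₗ[ℂ] Matrix (n × n') (n × n') ℂ where
  toFun τ := ∑ i : m, ∑ j : m, ∑ a : m', ∑ b : m',
    τ (i, a) (j, b) • (Φ (Matrix.single i j 1) ⊗ₖ Ω (Matrix.single a b 1))
  map_add' σ τ := by
    simp only [Matrix.add_apply, add_smul, Finset.sum_add_distrib]
  map_smul' c τ := by
    simp only [Matrix.smul_apply, smul_eq_mul, mul_smul, Finset.smul_sum, RingHom.id_apply]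

theorem tensorMap_kronecker {m n m' n' : Type*} [Fintype m] [DecidableEq m] [Fintype m']
    [DecidableEq m'] (Φ : Matrix m m ℂ →ₗ[ℂ] Matrix n n ℂ)
    (Ω : Matrix m' m' ℂ →ₗ[ℂ] Matrix n' n' ℂ) (A : Matrix m m ℂ) (B : Matrix m' m' ℂ) :
    tensorMap Φ Ω (A ⊗ₖ B) = Φ A ⊗ₖ Ω B := by
  have hA : Φ A = ∑ i, ∑ j, A i j • Φ (Matrix.single i j 1) := by
    conv_lhs => rw [Matrix.matrix_eq_sum_single A]
    simp only [map_sum]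
    refine Finset.sum_congr rfl fun i _ => Finset.sum_congr rfl fun j _ => ?_
    rw [← map_smul, Matrix.smul_single, smul_eq_mul, mul_one]
  have hB : Ω B = ∑ i, ∑ j, B i j • Ω (Matrix.single i j 1) := by
    conv_lhs => rw [Matrix.matrix_eq_sum_single B]
    simp only [map_sum]
    refine Finset.sum_congr rfl fun i _ => Finset.sum_congr rfl fun j _ => ?_
    rw [← map_smul, Matrix.smul_single, smul_eq_mul, mul_one]
  ext ⟨x, y⟩ ⟨z, w⟩
  rw [hA, hB]
  simp only [tensorMap, LinearMap.coe_mk, AddHom.coe_mk, Matrix.sum_apply, Matrix.smul_apply,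
    Matrix.kroneckerMap_apply, smul_eq_mul]
  simp only [Finset.sum_mul]
  refine Finset.sum_congr rfl fun i _ => Finset.sum_congr rfl fun j _ => ?_
  simp only [Finset.mul_sum]
  refine Finset.sum_congr rfl fun a _ => Finset.sum_congr rfl fun b _ => ?_
  ring

/-- Complete positivity: `id ⊗ Φ` preserves positive semidefiniteness for an ancilla of any
finite dimension. -/
def IsCompletelyPositive {m n : Type*} [Fintype m] [DecidableEq m]
    (Φ : Matrix m m ℂ →ₗ[ℂ] Matrix n n ℂ) : Prop :=
  ∀ (k : ℕ) (M : Matrix (Fin k × m) (Fin k × m) ℂ), M.PosSemidef →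
    (tensorMap (LinearMap.id : Matrix (Fin k) (Fin k) ℂ →ₗ[ℂ] Matrix (Fin k) (Fin k) ℂ) Φ
      M).PosSemidef

/-- A quantum channel: a completely positive trace-preserving linear map. -/
structure IsChannel {m n : Type*} [Fintype m] [DecidableEq m] [Fintype n]
    (Φ : Matrix m m ℂ →ₗ[ℂ] Matrix n n ℂ) : Prop where
  completelyPositive : IsCompletelyPositive Φ
  trace_map : ∀ ρ : Matrix m m ℂ, (Φ ρ).trace = ρ.trace

/-- An entanglement-breaking channel, in Holevo form: `Φ ρ = ∑ k, R k * Tr (X k * ρ)` with density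
matrices `R k` and a POVM `X`, i.e. `X k ≥ 0` and `∑ k, X k = 1`. -/
def IsEntanglementBreaking {m n : Type*} [Fintype m] [DecidableEq m] [Fintype n]
    (Φ : Matrix m m ℂ →ₗ[ℂ] Matrix n n ℂ) : Prop :=
  ∃ (K : ℕ) (R : Fin K → Matrix n n ℂ) (X : Fin K → Matrix m m ℂ),
    (∀ k, IsDensity (R k)) ∧ (∀ k, (X k).PosSemidef) ∧ ∑ k, X k = 1 ∧
      ∀ ρ : Matrix m m ℂ, Φ ρ = ∑ k, (X k * ρ).trace • R k

/-- The noncommutative `p`-norm `‖A‖_p = (Tr |A| ^ p) ^ (1 / p)`, where `|A| = (Aᴴ A) ^ (1 / 2)`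
and the powers are those of the continuous functional calculus. -/
def pNorm {n : Type*} [Fintype n] [DecidableEq n] (p : ℝ) (A : Matrix n n ℂ) : ℝ :=
  ((CFC.abs A ^ p).trace.re) ^ (1 / p)

/-- The set of output `p`-norms `‖Φ ρ‖_p`, with `ρ` a density matrix in the domain of `Φ`. -/
def outputNorms {m n : Type*} [Fintype m] [Fintype n] [DecidableEq n]
    (p : ℝ) (Φ : Matrix m m ℂ →ₗ[ℂ] Matrix n n ℂ) : Set ℝ :=
  {x | ∃ ρ : Matrix m m ℂ, IsDensity ρ ∧ x = pNorm p (Φ ρ)}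

/-- The maximal output `p`-norm `ν_p(Φ) = sup_ρ ‖Φ ρ‖_p` over density matrices `ρ`. -/
def maxNorm {m n : Type*} [Fintype m] [Fintype n] [DecidableEq n]
    (p : ℝ) (Φ : Matrix m m ℂ →ₗ[ℂ] Matrix n n ℂ) : ℝ :=
  sSup (outputNorms p Φ)

end QChannel

end

/-! Let `G k` be the partial trace of `(X k ⊗ 1) τ` over the first factor. The output is `∑ k, R k ⊗
Ω (G k)` (`tensorMap_holevo`), so the input enters only through the positive operators `G k`. Put `x
k = Tr (G k)` and move this weight onto `R k`. The output becomes `∑ k, (x k R k) ⊗ B k`, where `B k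
= Ω (G k) / x k` is an output of `Ω` at a density matrix (or `0`). Hence `Tr (B k) ^ p ≤ β = ν_p(Ω)
^ p`, while `∑ k, x k R k` is `Φ` of the first marginal of `τ`. The upper bound thus reduces to
`trace_sum_kronecker_rpow_le`.

For that inequality, let `M = ∑ k, R k` and `R k = A k (A k)ᴴ`, and let `Q k` diagonalize `B k`. The
block row `W` with blocks `M ^ (-1/2) A k ⊗ Q k` satisfies `W Wᴴ ≤ 1`, and `∑ k, R k ⊗ B k = C ^
(1/2) W D Wᴴ C ^ (1/2)`, where `C = M ⊗ 1` and `D` is diagonal with the eigenvalues of the `B k`.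
Complex interpolation (`sum_rpow_le_of_eq_sum`) bounds the trace of the `p`-th power by `Tr (C ^ p W
D ^ p Wᴴ)`. This is a sum over `k` in which `Tr (B k) ^ p ≤ β` factors out, leaving at most `β Tr M
^ p`.

Compactness gives maximizers for `Φ` and `Ω`. Their product attains the bound, because `Tr (A ⊗ B) ^
p` is multiplicative. -/

noncomputable section

namespace QChannel

/-! ### Traces of real powers through eigenvalues -/

section Spectral

variable {n : Type*} [Fintype n] [DecidableEq n]

theorem exists_eq_conjTranspose_mul_self {A : Matrix n n ℂ} (hA : A.PosSemidef) :
    ∃ C : Matrix n n ℂ, A = Cᴴ * C :=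
  CStarAlgebra.nonneg_iff_eq_star_mul_self.mp hA.nonneg

theorem exists_diagonalization {A : Matrix n n ℂ} (hA : A.PosSemidef) :
    ∃ (S : Matrix n n ℂ) (y : n → ℝ), (∀ i, 0 ≤ y i) ∧ Sᴴ * S = 1 ∧ S * Sᴴ = 1 ∧
      A = S * Matrix.diagonal (fun i => (y i : ℂ)) * Sᴴ := by
  refine ⟨hA.isHermitian.eigenvectorUnitary, hA.isHermitian.eigenvalues, hA.eigenvalues_nonneg,
    Unitary.coe_star_mul_self _, Unitary.coe_mul_star_self _, ?_⟩
  conv_lhs => rw [hA.isHermitian.spectral_theorem, Unitary.conjStarAlgAut_apply]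
  rfl

theorem trace_rpow_eq_sum_eigenvalues {A : Matrix n n ℂ} (hA : A.PosSemidef) (p : ℝ) :
    (A ^ p).trace.re = ∑ i, hA.isHermitian.eigenvalues i ^ p := by
  rw [CFC.rpow_eq_cfc_real (Matrix.nonneg_iff_posSemidef.2 hA), hA.isHermitian.cfc_eq,
    Matrix.IsHermitian.cfc, Unitary.conjStarAlgAut_apply, Matrix.trace_mul_comm, ← mul_assoc,
    Unitary.coe_star_mul_self, one_mul, Matrix.trace_diagonal]
  simp

/-- The roots of the characteristic polynomial determine the eigenvalues as a multiset, so any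
unitary diagonalization computes the trace, whatever its order or eigenbasis. -/
theorem trace_rpow_of_diagonalization {A S : Matrix n n ℂ} {y : n → ℝ} (hy : ∀ i, 0 ≤ y i)
    (hS : Sᴴ * S = 1) (hA : A = S * Matrix.diagonal (fun i => (y i : ℂ)) * Sᴴ) (p : ℝ) :
    (A ^ p).trace.re = ∑ i, y i ^ p := by
  have hpsd : A.PosSemidef := by
    rw [hA]
    refine Matrix.PosSemidef.mul_mul_conjTranspose_same ?_ S
    exact Matrix.posSemidef_diagonal_iff.2 fun i => by exact_mod_cast hy i
  have hchar : A.charpoly = ∏ i, (Polynomial.X - Polynomial.C (y i : ℂ)) := by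
    rw [hA, Matrix.charpoly_mul_comm, ← mul_assoc, hS, one_mul, Matrix.charpoly_diagonal]
  have hroots : Finset.univ.val.map (fun i => (hpsd.isHermitian.eigenvalues i : ℂ)) =
      Finset.univ.val.map (fun i => (y i : ℂ)) := by
    have h1 := hpsd.isHermitian.roots_charpoly_eq_eigenvalues
    have h3 : (∏ i, (Polynomial.X - Polynomial.C (y i : ℂ))).roots =
        Finset.univ.val.map (fun i => (y i : ℂ)) := by
      rw [← Polynomial.roots_multiset_prod_X_sub_C (Finset.univ.val.map fun i => (y i : ℂ)),
        Multiset.map_map]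
      rfl
    rw [hchar, h3] at h1
    exact h1.symm
  rw [trace_rpow_eq_sum_eigenvalues hpsd]
  have h2 := congrArg (fun s : Multiset ℂ => (s.map fun z => z.re ^ p).sum) hroots
  simpa [Multiset.map_map, Function.comp_def] using h2

theorem trace_rpow_nonneg {A : Matrix n n ℂ} (hA : A.PosSemidef) (p : ℝ) :
    0 ≤ (A ^ p).trace.re := by
  rw [trace_rpow_eq_sum_eigenvalues hA]
  exact Finset.sum_nonneg fun i _ => Real.rpow_nonneg (hA.eigenvalues_nonneg i) p

theorem pNorm_of_posSemidef {A : Matrix n n ℂ} (hA : A.PosSemidef) (p : ℝ) :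
    pNorm p A = ((A ^ p).trace.re) ^ (1 / p) := by
  rw [pNorm, CFC.abs_of_nonneg A (Matrix.nonneg_iff_posSemidef.2 hA)]

theorem trace_kronecker_rpow {m : Type*} [Fintype m] [DecidableEq m] {A : Matrix n n ℂ}
    {B : Matrix m m ℂ} (hA : A.PosSemidef) (hB : B.PosSemidef) (p : ℝ) :
    ((A ⊗ₖ B) ^ p).trace.re = (A ^ p).trace.re * (B ^ p).trace.re := by
  obtain ⟨S, y, hy, hS, -, h⟩ := exists_diagonalization hA
  obtain ⟨Q, z, hz, hQ, -, h'⟩ := exists_diagonalization hB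
  rw [trace_rpow_of_diagonalization hy hS h, trace_rpow_of_diagonalization hz hQ h',
    trace_rpow_of_diagonalization (S := S ⊗ₖ Q) (y := fun i => y i.1 * z i.2)
      (fun i => mul_nonneg (hy _) (hz _)), Finset.sum_mul_sum, Fintype.sum_prod_type]
  · exact Finset.sum_congr rfl fun i _ => Finset.sum_congr rfl fun j _ =>
      Real.mul_rpow (hy i) (hz j)
  · rw [Matrix.conjTranspose_kronecker, ← Matrix.mul_kronecker_mul, hS, hQ,
      Matrix.one_kronecker_one]
  · have : Matrix.diagonal (fun i : n × m => ((y i.1 * z i.2 : ℝ) : ℂ)) =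
        Matrix.diagonal (fun i => (y i : ℂ)) ⊗ₖ Matrix.diagonal (fun i => (z i : ℂ)) := by
      rw [Matrix.diagonal_kronecker_diagonal]; congr 1; ext i; simp
    rw [this, Matrix.conjTranspose_kronecker, ← Matrix.mul_kronecker_mul,
      ← Matrix.mul_kronecker_mul, ← h, ← h']

open scoped Matrix.Norms.L2Operator in
theorem continuousOn_trace_rpow {p : ℝ} (hp : 0 ≤ p) :
    ContinuousOn (fun A : Matrix n n ℂ => (A ^ p).trace.re) {A | A.PosSemidef} := by
  have h : ContinuousOn (fun A : Matrix n n ℂ => cfc (fun x : ℝ => x ^ p) A)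
      {A | A.PosSemidef} :=
    ContinuousOn.cfc_of_mem_nhdsSet (s := Set.univ) _ Filter.univ_mem
      continuousOn_id (fun A (hA : A.PosSemidef) => hA.isHermitian)
      (Real.continuous_rpow_const hp).continuousOn
  have h2 : Continuous fun A : Matrix n n ℂ => A.trace.re :=
    Complex.continuous_re.comp continuous_id.matrix_trace
  refine (h2.comp_continuousOn h).congr fun A hA => ?_
  simp only [Function.comp_apply]
  rw [CFC.rpow_eq_cfc_real (Matrix.nonneg_iff_posSemidef.2 hA)]

end Spectral

/-! ### A Lieb–Thirring type inequality by the three lines theorem -/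

section Interpolation

open Complex Complex.HadamardThreeLines

/-- The complex power `t ^ z` of a nonnegative real, with the value `0` at `t = 0` for every `z`,
so that it is entire in `z`. -/
def supportPow (t : ℝ) (z : ℂ) : ℂ := if t = 0 then 0 else (t : ℂ) ^ z

theorem differentiable_supportPow (t : ℝ) : Differentiable ℂ (supportPow t) := by
  unfold supportPow
  by_cases ht : t = 0
  · simp [ht]
  · have : (t : ℂ) ≠ 0 := by exact_mod_cast ht
    simp only [ht, if_false]
    exact fun z => (differentiableAt_id.const_cpow (Or.inl this))

theorem norm_supportPow_le {t : ℝ} (ht : 0 ≤ t) (z : ℂ) : ‖supportPow t z‖ ≤ t ^ z.re := by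
  unfold supportPow
  split_ifs with h
  · simpa using Real.rpow_nonneg ht _
  · rw [norm_cpow_eq_rpow_re_of_pos (lt_of_le_of_ne ht (Ne.symm h))]

theorem supportPow_ofReal {t : ℝ} (ht : 0 ≤ t) {r : ℝ} (hr : r ≠ 0) :
    supportPow t (r : ℂ) = ((t ^ r : ℝ) : ℂ) := by
  unfold supportPow
  split_ifs with h
  · simp [h, Real.zero_rpow hr]
  · rw [ofReal_cpow ht]

theorem supportPow_rpow_mul_self {t p : ℝ} (ht : 0 ≤ t) (hp : 1 ≤ p) :
    supportPow (t ^ p) ((1 - 1 / p : ℝ) : ℂ) * (t : ℂ) = ((t ^ p : ℝ) : ℂ) := by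
  have hp0 : p ≠ 0 := by positivity
  rcases ht.eq_or_lt with rfl | h
  · simp [Real.zero_rpow hp0]
  · have h1 : t ^ p ≠ 0 := (Real.rpow_pos_of_pos h p).ne'
    rw [supportPow, if_neg h1, ← ofReal_cpow (Real.rpow_nonneg ht p), ← Real.rpow_mul ht,
      ← ofReal_mul, mul_sub, mul_one, mul_one_div_cancel hp0, Real.rpow_sub_one h.ne',
      div_mul_cancel₀ _ h.ne']

theorem supportPow_isBigO {t : ℝ} (ht : 0 ≤ t) {h : ℂ → ℂ}
    (hh : ∀ z ∈ verticalClosedStrip 0 1, 0 ≤ (h z).re ∧ (h z).re ≤ 1) :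
    (fun z => supportPow t (h z)) =O[Filter.principal (verticalClosedStrip 0 1)]
      (fun _ => (1 : ℝ)) := by
  refine Asymptotics.isBigO_principal.2 ⟨1 + t, fun z hz => ?_⟩
  obtain ⟨h0, h1⟩ := hh z hz
  refine (norm_supportPow_le ht _).trans ?_
  rw [norm_one, mul_one]
  rcases le_total t 1 with ht1 | ht1
  · exact (Real.rpow_le_one ht ht1 h0).trans (by linarith)
  · calc t ^ (h z).re ≤ t ^ (1 : ℝ) := Real.rpow_le_rpow_of_exponent_le ht1 h1
      _ ≤ 1 + t := by rw [Real.rpow_one]; linarith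

variable {X J : Type*} [Fintype X] [Fintype J] [DecidableEq X]

theorem sum_norm_sq_vecMul {M : Matrix X J ℂ} {e : X → ℝ}
    (hM : M * Mᴴ = Matrix.diagonal fun x => (e x : ℂ)) (v : X → ℂ) :
    ∑ j, ‖∑ x, v x * M x j‖ ^ 2 = ∑ x, e x * ‖v x‖ ^ 2 := by
  have h : (v ᵥ* M) ⬝ᵥ star (v ᵥ* M) = ∑ x, (e x : ℂ) * (v x * star (v x)) := by
    rw [Matrix.star_vecMul, Matrix.dotProduct_mulVec, Matrix.vecMul_vecMul, hM]
    simp only [dotProduct, Matrix.vecMul_diagonal, Pi.star_apply]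
    exact Finset.sum_congr rfl fun x _ => by ring
  apply ofReal_injective
  push_cast
  simp only [← mul_conj']
  simpa [dotProduct, Matrix.vecMul] using h

theorem sum_norm_sq_vecMul_star {M : Matrix X J ℂ} {e : X → ℝ}
    (hM : M * Mᴴ = Matrix.diagonal fun x => (e x : ℂ)) (v : X → ℂ) :
    ∑ j, ‖∑ x, v x * star (M x j)‖ ^ 2 = ∑ x, e x * ‖v x‖ ^ 2 := by
  have h := sum_norm_sq_vecMul hM (star v)
  simp only [Pi.star_apply, norm_star] at h
  rw [← h]
  refine Finset.sum_congr rfl fun j _ => ?_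
  rw [← norm_star]
  simp [star_sum, mul_comm]

/-- A Lieb–Thirring type inequality in coordinates, proved by complex interpolation. -/
theorem sum_rpow_le_of_eq_sum {A : Type*} [Fintype A] [DecidableEq A] {S : Matrix X A ℂ}
    (hS : Sᴴ * S = 1) (hS' : S * Sᴴ = 1) {W : Matrix X J ℂ} {e : X → ℝ} (he : ∀ x, e x ≤ 1)
    (hW : W * Wᴴ = Matrix.diagonal fun x => (e x : ℂ))
    {κ : X → ℝ} (hκ : ∀ x, 0 ≤ κ x) {d : J → ℝ} (hd : ∀ j, 0 ≤ d j)
    {y : A → ℝ} (hy : ∀ a, 0 ≤ y a)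
    (hyd : ∀ a, y a = ∑ j, d j * ‖∑ x, star (S x a) * ((√(κ x) : ℝ) : ℂ) * W x j‖ ^ 2)
    {p : ℝ} (hp : 1 ≤ p) :
    ∑ a, y a ^ p ≤ ∑ j, d j ^ p * ∑ x, κ x ^ p * ‖W x j‖ ^ 2 := by
  have hp0 : 0 < p := by linarith
  have hκp : ∀ x, 0 ≤ κ x ^ p := fun x => Real.rpow_nonneg (hκ x) p
  have hdp : ∀ j, 0 ≤ d j ^ p := fun j => Real.rpow_nonneg (hd j) p
  have hyp : ∀ a, 0 ≤ y a ^ p := fun a => Real.rpow_nonneg (hy a) p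
  -- With `C`, `D`, `Y` the diagonal matrices of `κ`, `d`, `y`, the function `F z` is `Tr (Y ^ (p (1
  -- - z)) Sᴴ C ^ (p z / 2) W D ^ (p z) Wᴴ C ^ (p z / 2) S)`. The factor `N` replaces the conjugate
  -- of `L`, which would not be holomorphic; the two agree at real `z`.
  let L : A → J → ℂ → ℂ := fun a j z =>
    ∑ x, star (S x a) * supportPow (κ x ^ p) (z / 2) * W x j
  let N : A → J → ℂ → ℂ := fun a j z =>
    ∑ x, S x a * supportPow (κ x ^ p) (z / 2) * star (W x j)
  let F : ℂ → ℂ := fun z => ∑ a, ∑ j,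
    supportPow (d j ^ p) z * supportPow (y a ^ p) (1 - z) * (L a j z * N a j z)
  set T := ∑ a, y a ^ p with hT
  set V := ∑ j, d j ^ p * ∑ x, κ x ^ p * ‖W x j‖ ^ 2 with hV
  have hT0 : 0 ≤ T := Finset.sum_nonneg fun a _ => hyp a
  have hV0 : 0 ≤ V := Finset.sum_nonneg fun j _ => mul_nonneg (hdp j)
    (Finset.sum_nonneg fun x _ => mul_nonneg (hκp x) (sq_nonneg _))
  have hdiff : Differentiable ℂ F := by
    have h1 := differentiable_supportPow
    have h2 : ∀ t, Differentiable ℂ fun z => supportPow t (z / 2) := fun t =>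
      (h1 t).comp (differentiable_id.div_const 2)
    have h3 : ∀ t, Differentiable ℂ fun z => supportPow t (1 - z) := fun t =>
      (h1 t).comp (differentiable_id.const_sub 1)
    have h4 : ∀ t, Differentiable ℂ fun z => supportPow t z := h1
    simp only [F, L, N]
    fun_prop
  -- All exponents have real part in `[0, 1]` on the strip, so every factor is bounded there.
  have hbdd : BddAbove ((norm ∘ F) '' verticalClosedStrip 0 1) := by
    have hmul : ∀ {f g : ℂ → ℂ}, f =O[Filter.principal (verticalClosedStrip 0 1)]
        (fun _ => (1 : ℝ)) → g =O[Filter.principal (verticalClosedStrip 0 1)]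
        (fun _ => (1 : ℝ)) → (fun z => f z * g z) =O[Filter.principal (verticalClosedStrip 0 1)]
        (fun _ => (1 : ℝ)) := fun hf hg => by simpa using hf.mul hg
    have hconst : ∀ c : ℂ, (fun _ : ℂ => c) =O[Filter.principal (verticalClosedStrip 0 1)]
        (fun _ => (1 : ℝ)) := fun c => Asymptotics.isBigO_const_const c one_ne_zero _
    have hκb : ∀ x, (fun z : ℂ => supportPow (κ x ^ p) (z / 2))
        =O[Filter.principal (verticalClosedStrip 0 1)] (fun _ => (1 : ℝ)) := fun x =>
      supportPow_isBigO (hκp x) fun z (hz : 0 ≤ z.re ∧ z.re ≤ 1) => by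
        simp only [div_ofNat_re]; constructor <;> linarith [hz.1, hz.2]
    have hterm : ∀ a j, (fun z => supportPow (d j ^ p) z * supportPow (y a ^ p) (1 - z) *
        (L a j z * N a j z)) =O[Filter.principal (verticalClosedStrip 0 1)]
          (fun _ => (1 : ℝ)) := fun a j => by
      refine hmul (hmul (supportPow_isBigO (hdp j) fun z hz => hz)
        (supportPow_isBigO (hyp a) fun z (hz : 0 ≤ z.re ∧ z.re ≤ 1) => by
          simp only [sub_re, one_re]; constructor <;> linarith [hz.1, hz.2])) (hmul ?_ ?_)
      · exact Asymptotics.IsBigO.fun_sum fun x _ => hmul (hmul (hconst _) (hκb x)) (hconst _)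
      · exact Asymptotics.IsBigO.fun_sum fun x _ => hmul (hmul (hconst _) (hκb x)) (hconst _)
    have hF : F =O[Filter.principal (verticalClosedStrip 0 1)] (fun _ => (1 : ℝ)) :=
      Asymptotics.IsBigO.fun_sum fun a _ =>
        Asymptotics.IsBigO.fun_sum fun j _ => hterm a j
    obtain ⟨c, hc⟩ := Asymptotics.isBigO_principal.1 hF
    refine ⟨c, ?_⟩
    rintro _ ⟨z, hz, rfl⟩
    simpa using hc z hz
  have hprod : ∀ {s t : ℂ}, ‖s * t‖ ≤ (‖s‖ ^ 2 + ‖t‖ ^ 2) / 2 := fun {s t} => by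
    rw [norm_mul]; nlinarith [sq_nonneg (‖s‖ - ‖t‖)]
  have hone : ∀ a, ∑ x, ‖S x a‖ ^ 2 = 1 := fun a => by
    have h := congrFun (congrFun hS a) a
    rw [Matrix.mul_apply, Matrix.one_apply_eq] at h
    apply ofReal_injective
    push_cast
    rw [← h]
    exact Finset.sum_congr rfl fun x _ => by
      rw [Matrix.conjTranspose_apply, ← conj_mul', RCLike.star_def]
  -- On `re z = 0` the powers of `κ` and `d` have modulus at most `1`. As `W` is a contraction, the
  -- rows of `L` and `N` have norm at most `1`, and only the weights `y a ^ p` remain.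
  have hleft : ∀ z ∈ re ⁻¹' {(0 : ℝ)}, ‖F z‖ ≤ T := by
    intro z hz
    have hz : z.re = 0 := hz
    have hκ1 : ∀ x, ‖supportPow (κ x ^ p) (z / 2)‖ ≤ 1 := fun x => by
      simpa [div_ofNat_re, hz] using norm_supportPow_le (hκp x) (z / 2)
    have hrow : ∀ (a : A) (v : X → ℂ), (∀ x, ‖v x‖ ≤ ‖S x a‖) → ∑ x, e x * ‖v x‖ ^ 2 ≤ 1 := by
      intro a v hv
      rw [← hone a]
      refine Finset.sum_le_sum fun x _ => ?_
      have h1 : ‖v x‖ ^ 2 ≤ ‖S x a‖ ^ 2 := by gcongr; exact hv x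
      nlinarith [he x, sq_nonneg ‖v x‖]
    have hL : ∀ a, ∑ j, ‖L a j z‖ ^ 2 ≤ 1 := fun a => by
      simp only [L]
      rw [sum_norm_sq_vecMul hW]
      refine hrow a _ fun x => ?_
      rw [norm_mul, norm_star]
      exact mul_le_of_le_one_right (norm_nonneg _) (hκ1 x)
    have hN : ∀ a, ∑ j, ‖N a j z‖ ^ 2 ≤ 1 := fun a => by
      simp only [N]
      rw [sum_norm_sq_vecMul_star hW]
      refine hrow a _ fun x => ?_
      rw [norm_mul]
      exact mul_le_of_le_one_right (norm_nonneg _) (hκ1 x)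
    refine (norm_sum_le _ _).trans (Finset.sum_le_sum fun a _ => ?_)
    calc ‖∑ j, supportPow (d j ^ p) z * supportPow (y a ^ p) (1 - z) * (L a j z * N a j z)‖
        ≤ ∑ j, y a ^ p * ((‖L a j z‖ ^ 2 + ‖N a j z‖ ^ 2) / 2) := by
          refine (norm_sum_le _ _).trans (Finset.sum_le_sum fun j _ => ?_)
          rw [norm_mul, norm_mul]
          have h1 : ‖supportPow (d j ^ p) z‖ ≤ 1 := by
            simpa [hz] using norm_supportPow_le (hdp j) z
          have h2 : ‖supportPow (y a ^ p) (1 - z)‖ ≤ y a ^ p := by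
            simpa [hz] using norm_supportPow_le (hyp a) (1 - z)
          refine mul_le_mul ?_ hprod (norm_nonneg _) (hyp a)
          simpa using mul_le_mul h1 h2 (norm_nonneg _) zero_le_one
      _ = y a ^ p * ((∑ j, ‖L a j z‖ ^ 2 + ∑ j, ‖N a j z‖ ^ 2) / 2) := by
          rw [← Finset.mul_sum, ← Finset.sum_div, Finset.sum_add_distrib]
      _ ≤ y a ^ p := mul_le_of_le_one_right (hyp a) (by linarith [hL a, hN a])
  -- On `re z = 1` the roles swap: the powers of `y` are bounded by `1`, and `S`, being unitary,
  -- preserves the norms of the columns.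
  have hright : ∀ z ∈ re ⁻¹' {(1 : ℝ)}, ‖F z‖ ≤ V := by
    intro z hz
    have hz : z.re = 1 := hz
    have hS1 : S * Sᴴ = Matrix.diagonal fun _ : X => ((1 : ℝ) : ℂ) := by
      rw [hS']; simp
    have hcol : ∀ (j : J) (v : X → ℂ),
        (∀ x, ‖v x‖ ≤ ‖supportPow (κ x ^ p) (z / 2)‖ * ‖W x j‖) →
        ∑ x, 1 * ‖v x‖ ^ 2 ≤ ∑ x, κ x ^ p * ‖W x j‖ ^ 2 := by
      intro j v hv
      refine Finset.sum_le_sum fun x _ => ?_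
      have h1 : ‖supportPow (κ x ^ p) (z / 2)‖ ≤ √(κ x ^ p) := by
        rw [Real.sqrt_eq_rpow]
        simpa [div_ofNat_re, hz] using norm_supportPow_le (hκp x) (z / 2)
      calc 1 * ‖v x‖ ^ 2 ≤ (√(κ x ^ p) * ‖W x j‖) ^ 2 := by
            rw [one_mul]
            gcongr
            exact (hv x).trans (by gcongr)
        _ = κ x ^ p * ‖W x j‖ ^ 2 := by rw [mul_pow, Real.sq_sqrt (hκp x)]
    have hL : ∀ j, ∑ a, ‖L a j z‖ ^ 2 ≤ ∑ x, κ x ^ p * ‖W x j‖ ^ 2 := fun j => by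
      have h := sum_norm_sq_vecMul_star hS1 fun x => supportPow (κ x ^ p) (z / 2) * W x j
      calc ∑ a, ‖L a j z‖ ^ 2 = _ := by
            rw [← h]
            refine Finset.sum_congr rfl fun a _ => ?_
            congr 2
            exact Finset.sum_congr rfl fun x _ => by ring
        _ ≤ _ := hcol j _ fun x => (norm_mul _ _).le
    have hN : ∀ j, ∑ a, ‖N a j z‖ ^ 2 ≤ ∑ x, κ x ^ p * ‖W x j‖ ^ 2 := fun j => by
      have h := sum_norm_sq_vecMul hS1 fun x => supportPow (κ x ^ p) (z / 2) * star (W x j)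
      calc ∑ a, ‖N a j z‖ ^ 2 = _ := by
            rw [← h]
            refine Finset.sum_congr rfl fun a _ => ?_
            congr 2
            exact Finset.sum_congr rfl fun x _ => by ring
        _ ≤ _ := hcol j _ fun x => by rw [norm_mul, norm_star]
    simp only [F]
    rw [Finset.sum_comm]
    refine (norm_sum_le _ _).trans (Finset.sum_le_sum fun j _ => ?_)
    calc ‖∑ a, supportPow (d j ^ p) z * supportPow (y a ^ p) (1 - z) * (L a j z * N a j z)‖
        ≤ ∑ a, d j ^ p * ((‖L a j z‖ ^ 2 + ‖N a j z‖ ^ 2) / 2) := by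
          refine (norm_sum_le _ _).trans (Finset.sum_le_sum fun a _ => ?_)
          rw [norm_mul, norm_mul]
          have h1 : ‖supportPow (d j ^ p) z‖ ≤ d j ^ p := by
            simpa [hz] using norm_supportPow_le (hdp j) z
          have h2 : ‖supportPow (y a ^ p) (1 - z)‖ ≤ 1 := by
            simpa [hz] using norm_supportPow_le (hyp a) (1 - z)
          refine mul_le_mul ?_ hprod (norm_nonneg _) (hdp j)
          simpa using mul_le_mul h1 h2 (norm_nonneg _) (hdp j)
      _ = d j ^ p * ((∑ a, ‖L a j z‖ ^ 2 + ∑ a, ‖N a j z‖ ^ 2) / 2) := by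
          rw [← Finset.mul_sum, ← Finset.sum_div, Finset.sum_add_distrib]
      _ ≤ d j ^ p * ∑ x, κ x ^ p * ‖W x j‖ ^ 2 :=
          mul_le_mul_of_nonneg_left (by linarith [hL j, hN j]) (hdp j)
  -- At `z = 1 / p` the sum over `j` reproduces `y a`, and the remaining factor is `y a ^ (p - 1)`.
  have hval : F ((1 / p : ℝ) : ℂ) = (T : ℂ) := by
    have hpi : p * (1 / p) = 1 := mul_one_div_cancel hp0.ne'
    have hκs : ∀ x, supportPow (κ x ^ p) (((1 / p : ℝ) : ℂ) / 2) = ((√(κ x) : ℝ) : ℂ) := by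
      intro x
      have h : (((1 / p : ℝ) : ℂ) / 2) = ((1 / p / 2 : ℝ) : ℂ) := by push_cast; ring
      rw [h, supportPow_ofReal (hκp x) (by positivity), ← Real.rpow_mul (hκ x), ← mul_div_assoc,
        hpi, ← Real.sqrt_eq_rpow]
    have hds : ∀ j, supportPow (d j ^ p) ((1 / p : ℝ) : ℂ) = (d j : ℂ) := by
      intro j
      rw [supportPow_ofReal (hdp j) (by positivity), ← Real.rpow_mul (hd j), hpi, Real.rpow_one]
    have h1 : (1 : ℂ) - ((1 / p : ℝ) : ℂ) = ((1 - 1 / p : ℝ) : ℂ) := by push_cast; rfl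
    rw [hT, ofReal_sum]
    refine Finset.sum_congr rfl fun a _ => ?_
    rw [← supportPow_rpow_mul_self (hy a) hp]
    -- This also expands `y a` inside its `p`-th power; the later `← hyd a` folds that occurrence
    -- back.
    conv_rhs => rw [hyd a]
    rw [ofReal_sum, Finset.mul_sum, ← hyd a]
    refine Finset.sum_congr rfl fun j _ => ?_
    rw [h1, hds]
    have hN : N a j ((1 / p : ℝ) : ℂ) = star (L a j ((1 / p : ℝ) : ℂ)) := by
      simp only [N, L, hκs, star_sum, star_mul', star_star]
      exact Finset.sum_congr rfl fun x _ => by simp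
    rw [hN]
    simp only [L, hκs, RCLike.star_def, mul_conj']
    push_cast
    ring
  have hstrip : ((1 / p : ℝ) : ℂ) ∈ verticalClosedStrip 0 1 := by
    refine ⟨?_, ?_⟩
    · rw [ofReal_re]; positivity
    · rw [ofReal_re]; exact (div_le_one hp0).2 hp
  -- The three lines theorem gives `T ≤ T ^ (1 - 1 / p) * V ^ (1 / p)`; cancelling powers of `T > 0`
  -- yields `T ≤ V`.
  have hmain := norm_le_interp_of_mem_verticalClosedStrip₀₁' F hstrip hdiff.diffContOnCl hbdd
    hleft hright
  rw [hval, norm_real, Real.norm_of_nonneg hT0, ofReal_re] at hmain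
  rcases hT0.eq_or_lt with h0 | hpos
  · rw [← h0]; exact hV0
  · rw [Real.rpow_sub hpos, Real.rpow_one, div_mul_eq_mul_div, le_div_iff₀ (by positivity)] at hmain
    exact (Real.rpow_le_rpow_iff hT0 hV0 (by positivity)).1 (le_of_mul_le_mul_left hmain hpos)

end Interpolation

/-! ### The trace inequality for sums of Kronecker products -/

section BlockRow

variable {ι n m : Type*} [Fintype n] [Fintype m]

/-- The block row whose `k`-th block is `T k ⊗ Q k`. -/
def blockRow (T : ι → Matrix n n ℂ) (Q : ι → Matrix m m ℂ) : Matrix (n × m) (ι × n × m) ℂ :=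
  Matrix.of fun x j => T j.1 x.1 j.2.1 * Q j.1 x.2 j.2.2

theorem blockRow_mul_diagonal_mul_conjTranspose [Fintype ι] [DecidableEq m]
    [DecidableEq (ι × n × m)]
    (T : ι → Matrix n n ℂ) (Q : ι → Matrix m m ℂ) (b : ι → m → ℂ) :
    blockRow T Q * Matrix.diagonal (fun j : ι × n × m => b j.1 j.2.2) * (blockRow T Q)ᴴ =
      ∑ k, (T k * (T k)ᴴ) ⊗ₖ (Q k * Matrix.diagonal (b k) * (Q k)ᴴ) := by
  ext ⟨s, u⟩ ⟨t, w⟩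
  rw [Matrix.mul_apply, Matrix.sum_apply, Fintype.sum_prod_type]
  refine Finset.sum_congr rfl fun k _ => ?_
  rw [Matrix.kroneckerMap_apply, Matrix.mul_apply, Matrix.mul_apply, Finset.sum_mul_sum,
    Fintype.sum_prod_type]
  refine Finset.sum_congr rfl fun s' _ => Finset.sum_congr rfl fun l _ => ?_
  simp only [Matrix.mul_diagonal, Matrix.conjTranspose_apply, blockRow, Matrix.of_apply, star_mul']
  ring

theorem sum_norm_sq_row {n m : Type*} [Fintype m] (A : Matrix n m ℂ) (i : n) :
    ((∑ j, ‖A i j‖ ^ 2 : ℝ) : ℂ) = (A * Aᴴ) i i := by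
  rw [Matrix.mul_apply]
  push_cast
  exact Finset.sum_congr rfl fun j _ => by
    rw [Matrix.conjTranspose_apply, RCLike.star_def, Complex.mul_conj']

/-- For positive semidefinite `R k` and `B k` with `Tr (B k) ^ p ≤ β`, one has
`Tr (∑ k, R k ⊗ B k) ^ p ≤ β * Tr (∑ k, R k) ^ p`. -/
theorem trace_sum_kronecker_rpow_le [Fintype ι] [DecidableEq n] [DecidableEq m] {R : ι → Matrix n n ℂ} (hR : ∀ k, (R k).PosSemidef)
    {B : ι → Matrix m m ℂ} (hB : ∀ k, (B k).PosSemidef) {p : ℝ} (hp : 1 ≤ p) {β : ℝ}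
    (hβ0 : 0 ≤ β) (hβ : ∀ k, (B k ^ p).trace.re ≤ β) :
    ((∑ k, R k ⊗ₖ B k) ^ p).trace.re ≤ β * ((∑ k, R k) ^ p).trace.re := by
  classical
  have hfac : ∀ k, ∃ A : Matrix n n ℂ, R k = A * Aᴴ := fun k => by
    obtain ⟨C, hC⟩ := exists_eq_conjTranspose_mul_self (hR k)
    exact ⟨Cᴴ, by rw [hC, Matrix.conjTranspose_conjTranspose]⟩
  choose A hA using hfac
  choose Q b hb hQ hQ' hBQ using fun k => exists_diagonalization (hB k)
  obtain ⟨U, κ, hκ, hU, hU', hM⟩ :=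
    exists_diagonalization (Matrix.posSemidef_sum Finset.univ fun k _ => hR k)
  obtain ⟨S, y, hy, hS, hS', hY⟩ := exists_diagonalization
    (Matrix.posSemidef_sum Finset.univ fun k _ => (hR k).kronecker (hB k))
  rw [trace_rpow_of_diagonalization hy hS hY, trace_rpow_of_diagonalization hκ hU hM]
  have hβ' : ∀ k, ∑ l, b k l ^ p ≤ β := fun k => by
    rw [← trace_rpow_of_diagonalization (hb k) (hQ k) (hBQ k)]; exact hβ k
  set T : ι → Matrix n n ℂ := fun k => Uᴴ * A k with hT
  have hTT : ∑ k, T k * (T k)ᴴ = Matrix.diagonal fun s => (κ s : ℂ) := by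
    have h1 : ∀ k, T k * (T k)ᴴ = Uᴴ * R k * U := fun k => by
      simp only [hT, hA k, Matrix.conjTranspose_mul, Matrix.conjTranspose_conjTranspose,
        Matrix.mul_assoc]
    simp only [h1]
    rw [← Finset.sum_mul, ← Finset.mul_sum, hM]
    simp only [← Matrix.mul_assoc, hU, Matrix.one_mul]
    rw [Matrix.mul_assoc, hU, Matrix.mul_one]
  -- Since `0⁻¹ = 0`, this is the inverse square root on the support of `∑ k, R k`; hence `e` is `1`
  -- on the support and `0` on the kernel.
  set r : n → ℂ := fun s => (((√(κ s))⁻¹ : ℝ) : ℂ) with hr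
  set V : ι → Matrix n n ℂ := fun k => Matrix.diagonal r * T k with hV
  set e : n → ℝ := fun s => (√(κ s))⁻¹ * κ s * (√(κ s))⁻¹ with he
  have he1 : ∀ s, e s ≤ 1 := fun s => by
    rcases (hκ s).eq_or_lt with h | h
    · simp [he, ← h]
    · have : √(κ s) ≠ 0 := (Real.sqrt_pos.2 h).ne'
      refine le_of_eq ?_
      simp only [he]
      nth_rewrite 2 [← Real.mul_self_sqrt (hκ s)]
      field_simp
  have hVV : ∑ k, V k * (V k)ᴴ = Matrix.diagonal fun s => (e s : ℂ) := by
    have h1 : ∀ k, V k * (V k)ᴴ = Matrix.diagonal r * (T k * (T k)ᴴ) * Matrix.diagonal r :=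
      fun k => by
        have h2 : star r = r := by ext s; simp [hr]
        simp only [hV, Matrix.conjTranspose_mul, Matrix.diagonal_conjTranspose, h2,
          Matrix.mul_assoc]
    simp only [h1]
    rw [← Finset.sum_mul, ← Finset.mul_sum, hTT, Matrix.diagonal_mul_diagonal,
      Matrix.diagonal_mul_diagonal]
    congr 1
    ext s
    simp [hr, he]
  have hrowT : ∀ s, ∑ k, ∑ s', ‖T k s s'‖ ^ 2 = κ s := fun s => by
    have h := congrFun (congrFun hTT s) s
    rw [Matrix.diagonal_apply_eq, Matrix.sum_apply] at h
    apply Complex.ofReal_injective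
    rw [← h, Complex.ofReal_sum]
    exact Finset.sum_congr rfl fun k _ => sum_norm_sq_row (T k) s
  have hrowV : ∀ s, ∑ k, ∑ s', ‖V k s s'‖ ^ 2 = e s := fun s => by
    have h := congrFun (congrFun hVV s) s
    rw [Matrix.diagonal_apply_eq, Matrix.sum_apply] at h
    apply Complex.ofReal_injective
    rw [← h, Complex.ofReal_sum]
    exact Finset.sum_congr rfl fun k _ => sum_norm_sq_row (V k) s
  -- Where `κ s = 0` the factor `√(κ s)` cannot be undone, but there the whole row `s` of every `T
  -- k` vanishes, its total square norm being `κ s`.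
  have hVT : ∀ k s s', ((√(κ s) : ℝ) : ℂ) * V k s s' = T k s s' := fun k s s' => by
    simp only [hV, Matrix.diagonal_mul, hr]
    rcases (hκ s).eq_or_lt with h | h
    · have h0 : ∑ k, ∑ s', ‖T k s s'‖ ^ 2 = 0 := (hrowT s).trans h.symm
      have h1 := (Finset.sum_eq_zero_iff_of_nonneg fun k _ =>
        Finset.sum_nonneg fun s' _ => sq_nonneg ‖T k s s'‖).1 h0 k (Finset.mem_univ _)
      have h2 := (Finset.sum_eq_zero_iff_of_nonneg fun s' _ => sq_nonneg ‖T k s s'‖).1 h1 s'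
        (Finset.mem_univ _)
      have h3 : T k s s' = 0 := by simpa using h2
      rw [h3]; simp
    · have h0 : ((√(κ s) : ℝ) : ℂ) ≠ 0 := by exact_mod_cast (Real.sqrt_pos.2 h).ne'
      push_cast
      field_simp
  have hWW : blockRow V Q * (blockRow V Q)ᴴ =
      Matrix.diagonal fun x : n × m => ((e x.1 : ℝ) : ℂ) := by
    have h := blockRow_mul_diagonal_mul_conjTranspose V Q fun _ _ => 1
    rw [Matrix.diagonal_one, Matrix.mul_one] at h
    have h1 : ∀ k, Q k * Matrix.diagonal (fun _ => (1 : ℂ)) * (Q k)ᴴ = 1 := fun k => by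
      rw [Matrix.diagonal_one, Matrix.mul_one, hQ' k]
    simp only [h1] at h
    rw [h]
    ext ⟨s, u⟩ ⟨t, w⟩
    have h2 := congrFun (congrFun hVV s) t
    rw [Matrix.sum_apply] at h2
    simp only [Matrix.sum_apply, Matrix.kroneckerMap_apply]
    rw [← Finset.sum_mul, h2]
    by_cases hst : s = t
    · by_cases huw : u = w <;> simp [hst, huw, Matrix.one_apply]
    · simp [hst]
  -- The eigenbasis of the Kronecker sum, written in the coordinates where `∑ k, R k` is diagonal.
  set S₁ : Matrix (n × m) (n × m) ℂ := (Uᴴ ⊗ₖ 1) * S with hS₁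
  have hU1 : (Uᴴ ⊗ₖ (1 : Matrix m m ℂ))ᴴ = U ⊗ₖ 1 := by
    rw [Matrix.conjTranspose_kronecker, Matrix.conjTranspose_conjTranspose,
      Matrix.conjTranspose_one]
  have hS₁l : S₁ᴴ * S₁ = 1 := by
    rw [hS₁, Matrix.conjTranspose_mul, hU1, Matrix.mul_assoc, ← Matrix.mul_assoc (U ⊗ₖ 1),
      ← Matrix.mul_kronecker_mul, hU', Matrix.mul_one, Matrix.one_kronecker_one, Matrix.one_mul,
      hS]
  have hS₁r : S₁ * S₁ᴴ = 1 := mul_eq_one_comm.1 hS₁l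
  have hdiag : S₁ᴴ * (blockRow T Q * Matrix.diagonal (fun j : ι × n × m => (b j.1 j.2.2 : ℂ)) *
      (blockRow T Q)ᴴ) * S₁ = Matrix.diagonal fun a => (y a : ℂ) := by
    have h1 : blockRow T Q * Matrix.diagonal (fun j : ι × n × m => (b j.1 j.2.2 : ℂ)) * (blockRow T Q)ᴴ =
        (Uᴴ ⊗ₖ 1) * (∑ k, R k ⊗ₖ B k) * (U ⊗ₖ 1) := by
      rw [blockRow_mul_diagonal_mul_conjTranspose T Q fun k l => (b k l : ℂ), Finset.mul_sum,
        Finset.sum_mul]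
      refine Finset.sum_congr rfl fun k _ => ?_
      rw [← hBQ k, ← Matrix.mul_kronecker_mul, ← Matrix.mul_kronecker_mul, Matrix.one_mul,
        Matrix.mul_one]
      simp only [hT, hA k, Matrix.conjTranspose_mul, Matrix.conjTranspose_conjTranspose,
        Matrix.mul_assoc]
    have h2 : (U ⊗ₖ (1 : Matrix m m ℂ)) * S₁ = S := by
      rw [hS₁, ← Matrix.mul_assoc, ← Matrix.mul_kronecker_mul, hU', Matrix.mul_one,
        Matrix.one_kronecker_one, Matrix.one_mul]
    have h3 : S₁ᴴ * (Uᴴ ⊗ₖ (1 : Matrix m m ℂ)) = Sᴴ := by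
      conv_rhs => rw [← h2, Matrix.conjTranspose_mul, Matrix.conjTranspose_kronecker,
        Matrix.conjTranspose_one]
    rw [h1, Matrix.mul_assoc, Matrix.mul_assoc, Matrix.mul_assoc, h2, ← Matrix.mul_assoc, h3, hY]
    simp only [← Matrix.mul_assoc, hS, Matrix.one_mul]
    rw [Matrix.mul_assoc, hS, Matrix.mul_one]
  have hyd : ∀ a, y a = ∑ j : ι × n × m, b j.1 j.2.2 *
      ‖∑ x : n × m, star (S₁ x a) * ((√(κ x.1) : ℝ) : ℂ) * blockRow V Q x j‖ ^ 2 := by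
    intro a
    have h := congrFun (congrFun hdiag a) a
    have hcalc : S₁ᴴ * (blockRow T Q * Matrix.diagonal (fun j : ι × n × m => (b j.1 j.2.2 : ℂ)) *
        (blockRow T Q)ᴴ) * S₁ = (S₁ᴴ * blockRow T Q) *
          Matrix.diagonal (fun j : ι × n × m => (b j.1 j.2.2 : ℂ)) * (S₁ᴴ * blockRow T Q)ᴴ := by
      simp only [Matrix.conjTranspose_mul, Matrix.conjTranspose_conjTranspose, Matrix.mul_assoc]
    rw [hcalc, Matrix.diagonal_apply_eq, Matrix.mul_apply] at h
    apply Complex.ofReal_injective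
    rw [← h, Complex.ofReal_sum]
    refine Finset.sum_congr rfl fun j _ => ?_
    have hent : ∑ x : n × m, star (S₁ x a) * ((√(κ x.1) : ℝ) : ℂ) * blockRow V Q x j =
        (S₁ᴴ * blockRow T Q) a j := by
      rw [Matrix.mul_apply]
      refine Finset.sum_congr rfl fun x _ => ?_
      simp only [blockRow, Matrix.of_apply, Matrix.conjTranspose_apply, ← hVT]
      ring
    rw [hent, Matrix.mul_diagonal, Matrix.conjTranspose_apply, RCLike.star_def]
    push_cast
    rw [← Complex.mul_conj']
    ring
  have hcolQ : ∀ k l, ∑ u, ‖Q k u l‖ ^ 2 = 1 := fun k l => by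
    have h := sum_norm_sq_row (Q k)ᴴ l
    rw [Matrix.conjTranspose_conjTranspose, hQ k, Matrix.one_apply_eq] at h
    simp only [Matrix.conjTranspose_apply, norm_star] at h
    exact_mod_cast h
  calc ∑ a, y a ^ p
      ≤ ∑ j : ι × n × m, b j.1 j.2.2 ^ p * ∑ x : n × m, κ x.1 ^ p * ‖blockRow V Q x j‖ ^ 2 :=
        sum_rpow_le_of_eq_sum hS₁l hS₁r (fun x => he1 x.1) hWW (fun x => hκ x.1)
          (fun j => hb j.1 j.2.2) hy hyd hp
    -- The columns of `Q k` are unit vectors, so summing over the second coordinate removes `Q k`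
    -- and decouples the eigenvalues of `B k` from `V k`.
    _ = ∑ k, (∑ l, b k l ^ p) * ∑ s', ∑ s, κ s ^ p * ‖V k s s'‖ ^ 2 := by
        rw [Fintype.sum_prod_type]
        refine Finset.sum_congr rfl fun k _ => ?_
        rw [Fintype.sum_prod_type, mul_comm, Finset.sum_mul_sum]
        refine Finset.sum_congr rfl fun s' _ => Finset.sum_congr rfl fun l _ => ?_
        rw [mul_comm, Fintype.sum_prod_type]
        congr 1
        refine Finset.sum_congr rfl fun s _ => ?_
        simp only [blockRow, Matrix.of_apply, norm_mul, mul_pow]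
        rw [← Finset.mul_sum, ← Finset.mul_sum, hcolQ, mul_one]
    _ ≤ ∑ k, β * ∑ s', ∑ s, κ s ^ p * ‖V k s s'‖ ^ 2 := by
        refine Finset.sum_le_sum fun k _ => mul_le_mul_of_nonneg_right (hβ' k) ?_
        exact Finset.sum_nonneg fun s' _ => Finset.sum_nonneg fun s _ =>
          mul_nonneg (Real.rpow_nonneg (hκ s) p) (sq_nonneg _)
    _ = β * ∑ s, κ s ^ p * e s := by
        rw [← Finset.mul_sum]
        congr 1
        simp only [← hrowV, Finset.mul_sum]
        rw [Finset.sum_comm' (s' := fun _ => Finset.univ) (t' := Finset.univ) (by simp)]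
        rw [Finset.sum_comm]
        conv_rhs => rw [Finset.sum_comm]
        refine Finset.sum_congr rfl fun k _ => ?_
        rw [Finset.sum_comm]
    _ ≤ β * ∑ s, κ s ^ p := by
        refine mul_le_mul_of_nonneg_left (Finset.sum_le_sum fun s _ => ?_) hβ0
        exact mul_le_of_le_one_right (Real.rpow_nonneg (hκ s) p) (he1 s)

end BlockRow

/-! ### Compactness and products of density matrices -/

section Density

variable {m : Type*} [Fintype m]

theorem trace_conjTranspose_mul_self_eq_sum (B : Matrix m m ℂ) :
    (Bᴴ * B).trace = ((∑ j, ∑ i, ‖B i j‖ ^ 2 : ℝ) : ℂ) := by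
  simp only [Matrix.trace, Matrix.diag_apply, Matrix.mul_apply, Matrix.conjTranspose_apply]
  push_cast
  exact Finset.sum_congr rfl fun j _ => Finset.sum_congr rfl fun i _ => by
    rw [RCLike.star_def, Complex.conj_mul']

/-- Density matrices are the image under `B ↦ Bᴴ * B` of the Hilbert–Schmidt unit sphere, which is
closed with entries in the unit disc. -/
theorem isCompact_setOf_isDensity : IsCompact {ρ : Matrix m m ℂ | IsDensity ρ} := by
  classical
  have hbox : IsCompact {B : Matrix m m ℂ | ∀ i j, B i j ∈ Metric.closedBall (0 : ℂ) 1} := by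
    have h : IsCompact (Set.univ.pi fun _ : m => Set.univ.pi fun _ : m =>
        Metric.closedBall (0 : ℂ) 1) :=
      isCompact_univ_pi fun _ => isCompact_univ_pi fun _ => isCompact_closedBall 0 1
    have heq : {B : Matrix m m ℂ | ∀ i j, B i j ∈ Metric.closedBall (0 : ℂ) 1} =
        Set.univ.pi fun _ : m => Set.univ.pi fun _ : m => Metric.closedBall (0 : ℂ) 1 := by
      refine Set.ext fun B => ⟨fun hB i _ j _ => hB i j, fun hB i j => hB i trivial j trivial⟩
    rw [heq]
    exact h
  have hcont : Continuous fun B : Matrix m m ℂ => Bᴴ * B :=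
    (continuous_id.matrix_conjTranspose).matrix_mul continuous_id
  have hclosed : IsClosed {B : Matrix m m ℂ | (Bᴴ * B).trace = 1} :=
    isClosed_eq hcont.matrix_trace continuous_const
  convert (hbox.inter_right hclosed).image hcont using 1
  ext ρ
  constructor
  · rintro ⟨hpos, htr⟩
    obtain ⟨B, rfl⟩ := exists_eq_conjTranspose_mul_self hpos
    refine ⟨B, ⟨fun i j => ?_, htr⟩, rfl⟩
    rw [trace_conjTranspose_mul_self_eq_sum] at htr
    have h1 : ∑ j, ∑ i, ‖B i j‖ ^ 2 = 1 := by exact_mod_cast htr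
    have h2 : ‖B i j‖ ^ 2 ≤ 1 := by
      rw [← h1]
      calc ‖B i j‖ ^ 2 ≤ ∑ i, ‖B i j‖ ^ 2 :=
            Finset.single_le_sum (f := fun i => ‖B i j‖ ^ 2) (fun _ _ => sq_nonneg _)
              (Finset.mem_univ i)
        _ ≤ _ := Finset.single_le_sum (f := fun j => ∑ i, ‖B i j‖ ^ 2)
              (fun _ _ => Finset.sum_nonneg fun _ _ => sq_nonneg _) (Finset.mem_univ j)
    rw [mem_closedBall_zero_iff]
    exact (sq_le_one_iff₀ (norm_nonneg _)).1 h2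
  · rintro ⟨B, ⟨-, hB⟩, rfl⟩
    exact ⟨Matrix.posSemidef_conjTranspose_mul_self B, hB⟩

theorem exists_isDensity [Nonempty m] : ∃ ρ : Matrix m m ℂ, IsDensity ρ := by
  classical
  obtain ⟨i⟩ := ‹Nonempty m›
  refine ⟨Matrix.diagonal (Pi.single i 1), Matrix.posSemidef_diagonal_iff.2 fun j => ?_, ?_⟩
  · by_cases h : j = i
    · subst h; simp
    · simp [h]
  · simp [Matrix.trace_diagonal]

theorem IsDensity.kronecker {m' : Type*} [Fintype m'] {ρ : Matrix m m ℂ} {σ : Matrix m' m' ℂ}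
    (hρ : IsDensity ρ) (hσ : IsDensity σ) : IsDensity (ρ ⊗ₖ σ) :=
  ⟨hρ.posSemidef.kronecker hσ.posSemidef, by
    rw [Matrix.trace_kronecker, hρ.trace_eq_one, hσ.trace_eq_one, one_mul]⟩

end Density

/-! ### Existence of maximizers and homogeneous bounds -/

section Maximizer

variable {m n : Type*} [Fintype m] [Fintype n] [DecidableEq n]

theorem exists_isDensity_forall_trace_rpow_le [Nonempty m] {Ω : Matrix m m ℂ →ₗ[ℂ] Matrix n n ℂ}
    (hΩ : ∀ G : Matrix m m ℂ, G.PosSemidef → (Ω G).PosSemidef) {p : ℝ} (hp : 0 ≤ p) :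
    ∃ σ, IsDensity σ ∧ ∀ ρ, IsDensity ρ → ((Ω ρ) ^ p).trace.re ≤ ((Ω σ) ^ p).trace.re := by
  have hcont : ContinuousOn (fun ρ => ((Ω ρ) ^ p).trace.re) {ρ | IsDensity ρ} :=
    (continuousOn_trace_rpow hp).comp
      (LinearMap.continuous_of_finiteDimensional Ω).continuousOn
      fun ρ (hρ : IsDensity ρ) => hΩ ρ hρ.posSemidef
  obtain ⟨σ, hσ, hmax⟩ := isCompact_setOf_isDensity.exists_isMaxOn exists_isDensity hcont
  exact ⟨σ, hσ, fun ρ hρ => hmax hρ⟩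

theorem isGreatest_outputNorms_of_forall_trace_rpow_le {Ω : Matrix m m ℂ →ₗ[ℂ] Matrix n n ℂ}
    (hΩ : ∀ ρ : Matrix m m ℂ, IsDensity ρ → (Ω ρ).PosSemidef) {p : ℝ} (hp : 0 < p)
    {σ : Matrix m m ℂ} (hσ : IsDensity σ)
    (hmax : ∀ ρ, IsDensity ρ → ((Ω ρ) ^ p).trace.re ≤ ((Ω σ) ^ p).trace.re) :
    IsGreatest (outputNorms p Ω) (pNorm p (Ω σ)) := by
  refine ⟨⟨σ, hσ, rfl⟩, ?_⟩
  rintro _ ⟨ρ, hρ, rfl⟩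
  rw [pNorm_of_posSemidef (hΩ ρ hρ), pNorm_of_posSemidef (hΩ σ hσ)]
  exact Real.rpow_le_rpow (trace_rpow_nonneg (hΩ ρ hρ) p) (hmax ρ hρ) (by positivity)

theorem trace_rpow_le_of_posSemidef {Ω : Matrix m m ℂ →ₗ[ℂ] Matrix n n ℂ}
    {p N : ℝ} (hp : 0 < p)
    (hN : 0 ≤ N) (hmax : ∀ ρ, IsDensity ρ → ((Ω ρ) ^ p).trace.re ≤ N)
    {G : Matrix m m ℂ} (hG : G.PosSemidef) :
    (((((G.trace.re)⁻¹ : ℝ) : ℂ) • Ω G) ^ p).trace.re ≤ N := by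
  have hre : (G.trace.re : ℂ) = G.trace := by
    obtain ⟨-, him⟩ := Complex.nonneg_iff.1 hG.trace_nonneg
    exact Complex.ext (by simp) (by simpa using him)
  rw [← map_smul]
  by_cases ht : G.trace.re = 0
  · have hG0 : G = 0 := hG.trace_eq_zero_iff.1 (by rw [← hre, ht, Complex.ofReal_zero])
    rw [trace_rpow_of_diagonalization (y := 0) (S := 1) (fun _ => le_rfl) (by simp)
      (by simp [hG0])]
    simpa [Real.zero_rpow hp.ne'] using hN
  · refine hmax _ ⟨hG.smul ?_, ?_⟩
    · have : 0 ≤ G.trace.re := (Complex.nonneg_iff.1 hG.trace_nonneg).1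
      exact_mod_cast inv_nonneg.2 this
    · rw [Matrix.trace_smul, ← hre, smul_eq_mul, ← Complex.ofReal_mul]
      simp [inv_mul_cancel₀ ht]

end Maximizer

/-! ### Complete positivity implies positivity -/

section Positivity

variable {m n : Type*} [Fintype m] [DecidableEq m]

/-- A one-dimensional ancilla suffices. -/
theorem IsCompletelyPositive.posSemidef_map {Ω : Matrix m m ℂ →ₗ[ℂ] Matrix n n ℂ}
    (hΩ : IsCompletelyPositive Ω) {G : Matrix m m ℂ} (hG : G.PosSemidef) :
    (Ω G).PosSemidef := by
  have h := hΩ 1 ((1 : Matrix (Fin 1) (Fin 1) ℂ) ⊗ₖ G) (Matrix.PosSemidef.one.kronecker hG)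
  rw [tensorMap_kronecker] at h
  convert h.submatrix (fun i : n => ((0 : Fin 1), i)) using 1
  ext i j
  simp

end Positivity

/-! ### Conditional operators, marginals and the Holevo form -/

section Conditional

variable {m m' : Type*} [Fintype m]

/-- The partial trace over the first factor of `(X ⊗ 1) τ`. -/
def conditional (X : Matrix m m ℂ) (τ : Matrix (m × m') (m × m') ℂ) : Matrix m' m' ℂ :=
  Matrix.of fun a b => ∑ i, ∑ j, X j i * τ (i, a) (j, b)

theorem posSemidef_conditional [Fintype m'] {X : Matrix m m ℂ} (hX : X.PosSemidef)
    {τ : Matrix (m × m') (m × m') ℂ} (hτ : τ.PosSemidef) : (conditional X τ).PosSemidef := by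
  classical
  obtain ⟨C, rfl⟩ := exists_eq_conjTranspose_mul_self hX
  -- Kraus operators: `E c` is row `c` of `C`, as a functional on the first factor, tensored with
  -- the identity on the second.
  let E : m → Matrix m' (m × m') ℂ := fun c => Matrix.of fun a x => if x.2 = a then C c x.1 else 0
  have h : conditional (Cᴴ * C) τ = ∑ c, E c * τ * (E c)ᴴ := by
    ext a b
    rw [Matrix.sum_apply]
    have hc : ∀ c, (E c * τ * (E c)ᴴ) a b =
        ∑ j, ∑ i, C c i * τ (i, a) (j, b) * star (C c j) := fun c => by
      simp only [Matrix.mul_apply, Matrix.conjTranspose_apply, E, Matrix.of_apply,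
        Fintype.sum_prod_type, ite_mul, zero_mul, Finset.sum_ite_eq', Finset.mem_univ, if_true,
        apply_ite star, star_zero, mul_ite, mul_zero, Finset.sum_mul]
    simp only [hc, conditional, Matrix.of_apply, Matrix.mul_apply, Matrix.conjTranspose_apply,
      Finset.sum_mul]
    rw [Finset.sum_comm]
    conv_rhs => rw [Finset.sum_comm]
    refine Finset.sum_congr rfl fun j _ => ?_
    conv_rhs => rw [Finset.sum_comm]
    refine Finset.sum_congr rfl fun i _ => Finset.sum_congr rfl fun c _ => ?_
    ring
  rw [h]
  exact Matrix.posSemidef_sum _ fun c _ => hτ.mul_mul_conjTranspose_same (E c)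

/-- The partial trace over the second factor. -/
def marginal [Fintype m'] (τ : Matrix (m × m') (m × m') ℂ) : Matrix m m ℂ :=
  Matrix.of fun i j => ∑ a, τ (i, a) (j, a)

theorem isDensity_marginal [Fintype m'] {τ : Matrix (m × m') (m × m') ℂ} (hτ : IsDensity τ) :
    IsDensity (marginal τ) := by
  classical
  refine ⟨?_, ?_⟩
  · convert posSemidef_conditional (Matrix.PosSemidef.one (n := m') (R := ℂ))
      (hτ.posSemidef.submatrix (Prod.swap : m' × m → m × m')) using 1
    ext i j
    simp [marginal, conditional, Matrix.one_apply]
  · rw [← hτ.trace_eq_one]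
    simp [Matrix.trace, marginal, Fintype.sum_prod_type]

theorem trace_conditional [Fintype m'] (X : Matrix m m ℂ) (τ : Matrix (m × m') (m × m') ℂ) :
    (conditional X τ).trace = (X * marginal τ).trace := by
  simp only [Matrix.trace, Matrix.diag_apply, conditional, marginal, Matrix.of_apply,
    Matrix.mul_apply, Finset.mul_sum]
  rw [Finset.sum_comm]
  conv_rhs => rw [Finset.sum_comm]
  refine Finset.sum_congr rfl fun i _ => ?_
  rw [Finset.sum_comm]

theorem tensorMap_holevo {n n' ι : Type*} [DecidableEq m] [Fintype m'] [DecidableEq m'] [Fintype ι]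
    {Φ : Matrix m m ℂ →ₗ[ℂ] Matrix n n ℂ} {R : ι → Matrix n n ℂ} {X : ι → Matrix m m ℂ}
    (hΦ : ∀ ρ, Φ ρ = ∑ k, (X k * ρ).trace • R k) (Ω : Matrix m' m' ℂ →ₗ[ℂ] Matrix n' n' ℂ)
    (τ : Matrix (m × m') (m × m') ℂ) :
    tensorMap Φ Ω τ = ∑ k, R k ⊗ₖ Ω (conditional (X k) τ) := by
  have hΩ : ∀ G : Matrix m' m' ℂ, Ω G = ∑ a, ∑ b, G a b • Ω (Matrix.single a b 1) := fun G => by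
    conv_lhs => rw [Matrix.matrix_eq_sum_single G]
    simp only [map_sum]
    refine Finset.sum_congr rfl fun a _ => Finset.sum_congr rfl fun b _ => ?_
    rw [← map_smul, Matrix.smul_single, smul_eq_mul, mul_one]
  have hc : ∀ k, Ω (conditional (X k) τ) =
      ∑ a, ∑ b, conditional (X k) τ a b • Ω (Matrix.single a b 1) := fun k => hΩ _
  have hs : ∀ i j, Φ (Matrix.single i j 1) = ∑ k, X k j i • R k := fun i j => by
    rw [hΦ]
    refine Finset.sum_congr rfl fun k _ => ?_
    rw [Matrix.trace_mul_single]
    simp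
  ext ⟨s, u⟩ ⟨t, w⟩
  simp only [hc]
  simp only [tensorMap, LinearMap.coe_mk, AddHom.coe_mk, hs,
    Matrix.sum_apply, Matrix.smul_apply, Matrix.kroneckerMap_apply, smul_eq_mul, conditional,
    Matrix.of_apply, Finset.mul_sum, Finset.sum_mul]
  simp only [← Fintype.sum_prod_type']
  refine Fintype.sum_equiv
    ⟨fun x => (x.2.2.2.2, x.2.2.1, x.2.2.2.1, x.1, x.2.1),
      fun x => (x.2.2.2.1, x.2.2.2.2, x.2.1, x.2.2.1, x.1), fun _ => rfl, fun _ => rfl⟩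
    _ _ fun x => ?_
  simp only [Equiv.coe_fn_mk]
  ring

end Conditional

/-! ### The upper bound for the tensor product -/

section Multiplicativity

theorem posSemidef_holevo {m n ι : Type*} [Fintype m] [Fintype ι] {Φ : Matrix m m ℂ →ₗ[ℂ] Matrix n n ℂ}
    {R : ι → Matrix n n ℂ} {X : ι → Matrix m m ℂ} (hR : ∀ k, (R k).PosSemidef)
    (hX : ∀ k, (X k).PosSemidef) (hΦ : ∀ ρ, Φ ρ = ∑ k, (X k * ρ).trace • R k)
    {ρ : Matrix m m ℂ} (hρ : ρ.PosSemidef) : (Φ ρ).PosSemidef := by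
  rw [hΦ]
  classical
  refine Matrix.posSemidef_sum _ fun k _ => (hR k).smul ?_
  obtain ⟨C, hC⟩ := exists_eq_conjTranspose_mul_self (hX k)
  rw [hC, Matrix.mul_assoc, Matrix.trace_mul_comm]
  exact (hρ.mul_mul_conjTranspose_same C).trace_nonneg

variable {m n m' n' : Type*} [Fintype m] [DecidableEq m] [Fintype n] [DecidableEq n]
  [Fintype m'] [DecidableEq m'] [Fintype n'] [DecidableEq n']

theorem trace_tensorMap_rpow_le {ι : Type*} [Fintype ι] {Φ : Matrix m m ℂ →ₗ[ℂ] Matrix n n ℂ}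
    {R : ι → Matrix n n ℂ} {X : ι → Matrix m m ℂ} (hR : ∀ k, (R k).PosSemidef)
    (hX : ∀ k, (X k).PosSemidef) (hΦ : ∀ ρ, Φ ρ = ∑ k, (X k * ρ).trace • R k)
    {Ω : Matrix m' m' ℂ →ₗ[ℂ] Matrix n' n' ℂ}
    (hΩ : ∀ G : Matrix m' m' ℂ, G.PosSemidef → (Ω G).PosSemidef) {p N : ℝ} (hp : 1 ≤ p)
    (hN : 0 ≤ N) (hmax : ∀ σ, IsDensity σ → ((Ω σ) ^ p).trace.re ≤ N)
    {τ : Matrix (m × m') (m × m') ℂ} (hτ : τ.PosSemidef) :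
    ((tensorMap Φ Ω τ) ^ p).trace.re ≤ N * ((Φ (marginal τ)) ^ p).trace.re := by
  set G : ι → Matrix m' m' ℂ := fun k => conditional (X k) τ with hGdef
  have hG : ∀ k, (G k).PosSemidef := fun k => posSemidef_conditional (hX k) hτ
  have hnn : ∀ k, 0 ≤ (G k).trace.re := fun k => (Complex.nonneg_iff.1 (hG k).trace_nonneg).1
  have hre : ∀ k, ((G k).trace.re : ℂ) = (X k * marginal τ).trace := fun k => by
    obtain ⟨-, him⟩ := Complex.nonneg_iff.1 (hG k).trace_nonneg
    rw [← trace_conditional]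
    exact Complex.ext (by simp [hGdef]) (by simpa using him)
  have hleft : tensorMap Φ Ω τ =
      ∑ k, (((G k).trace.re : ℂ) • R k) ⊗ₖ (((((G k).trace.re)⁻¹ : ℝ) : ℂ) • Ω (G k)) := by
    rw [tensorMap_holevo hΦ]
    refine Finset.sum_congr rfl fun k _ => ?_
    rw [Matrix.smul_kronecker, Matrix.kronecker_smul, smul_smul, ← Complex.ofReal_mul]
    -- Rescaling by `x * x⁻¹` is harmless even at `x = 0`, since a positive semidefinite `G k` of
    -- trace zero is itself zero.
    by_cases h : (G k).trace.re = 0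
    · have h0 : (G k).trace = 0 := by
        rw [trace_conditional, ← hre k, h, Complex.ofReal_zero]
      have hG0 : G k = 0 := (hG k).trace_eq_zero_iff.1 h0
      have : conditional (X k) τ = 0 := hG0
      simp [this, hG0]
    · rw [mul_inv_cancel₀ h, Complex.ofReal_one, one_smul]
  have hright : Φ (marginal τ) = ∑ k, ((G k).trace.re : ℂ) • R k := by
    rw [hΦ]
    exact Finset.sum_congr rfl fun k _ => by rw [hre k]
  rw [hleft, hright]
  exact trace_sum_kronecker_rpow_le (fun k => (hR k).smul (by exact_mod_cast hnn k))
    (fun k => (hΩ _ (hG k)).smul (by exact_mod_cast inv_nonneg.2 (hnn k))) hp hN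
    fun k => trace_rpow_le_of_posSemidef (by linarith) hN hmax (hG k)

end Multiplicativity

end QChannel

end

theorem theorem1 {m n m' n' : Type*}
    [Fintype m] [DecidableEq m] [Nonempty m] [Fintype n] [DecidableEq n]
    [Fintype m'] [DecidableEq m'] [Nonempty m'] [Fintype n'] [DecidableEq n']
    (Φ : Matrix m m ℂ →ₗ[ℂ] Matrix n n ℂ) (hΦ : QChannel.IsEntanglementBreaking Φ)
    (Ω : Matrix m' m' ℂ →ₗ[ℂ] Matrix n' n' ℂ) (hΩ : QChannel.IsChannel Ω)
    (p : ℝ) (hp : 1 ≤ p) :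
    QChannel.maxNorm p (QChannel.tensorMap Φ Ω) =
        QChannel.maxNorm p Φ * QChannel.maxNorm p Ω ∧
      ∃ (ρ : Matrix m m ℂ) (σ : Matrix m' m' ℂ),
        QChannel.IsDensity ρ ∧ QChannel.IsDensity σ ∧
        IsGreatest (QChannel.outputNorms p (QChannel.tensorMap Φ Ω))
          (QChannel.pNorm p (QChannel.tensorMap Φ Ω (ρ ⊗ₖ σ))) := by
  open QChannel in
  obtain ⟨K, R, X, hR, hX, -, hform⟩ := hΦ
  have hp0 : 0 < p := by linarith
  have hRpos := fun k => (hR k).posSemidef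
  have hΦpos : ∀ ρ : Matrix m m ℂ, ρ.PosSemidef → (Φ ρ).PosSemidef := fun ρ hρ =>
    posSemidef_holevo hRpos hX hform hρ
  have hΩpos : ∀ G : Matrix m' m' ℂ, G.PosSemidef → (Ω G).PosSemidef := fun G hG =>
    hΩ.completelyPositive.posSemidef_map hG
  obtain ⟨ρ, hρ, hρmax⟩ := exists_isDensity_forall_trace_rpow_le hΦpos hp0.le
  obtain ⟨σ, hσ, hσmax⟩ := exists_isDensity_forall_trace_rpow_le hΩpos hp0.le
  have hA := hΦpos ρ hρ.posSemidef
  have hB := hΩpos σ hσ.posSemidef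
  have htrace := trace_kronecker_rpow hA hB p
  have hpos : ∀ τ : Matrix (m × m') (m × m') ℂ, IsDensity τ → (tensorMap Φ Ω τ).PosSemidef := by
    intro τ hτ
    rw [tensorMap_holevo hform]
    exact Matrix.posSemidef_sum _ fun k _ =>
      (hRpos k).kronecker (hΩpos _ (posSemidef_conditional (hX k) hτ.posSemidef))
  have hgreatest : IsGreatest (outputNorms p (tensorMap Φ Ω))
      (pNorm p (tensorMap Φ Ω (ρ ⊗ₖ σ))) := by
    refine isGreatest_outputNorms_of_forall_trace_rpow_le hpos hp0 (hρ.kronecker hσ)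
      fun τ hτ => ?_
    -- An arbitrary `τ` is compared with `ρ ⊗ σ` through its first marginal, a density matrix, at
    -- which `Φ` is dominated by its value at `ρ`.
    rw [tensorMap_kronecker, htrace, mul_comm]
    exact (trace_tensorMap_rpow_le hRpos hX hform hΩpos hp (trace_rpow_nonneg hB p) hσmax
      hτ.posSemidef).trans (mul_le_mul_of_nonneg_left (hρmax _ (isDensity_marginal hτ))
        (trace_rpow_nonneg hB p))
  refine ⟨?_, ρ, σ, hρ, hσ, hgreatest⟩
  rw [maxNorm, maxNorm, maxNorm, hgreatest.csSup_eq,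
    (isGreatest_outputNorms_of_forall_trace_rpow_le (fun τ hτ => hΦpos τ hτ.posSemidef) hp0 hρ
      hρmax).csSup_eq,
    (isGreatest_outputNorms_of_forall_trace_rpow_le (fun τ hτ => hΩpos τ hτ.posSemidef) hp0 hσ
      hσmax).csSup_eq, tensorMap_kronecker, pNorm_of_posSemidef hA, pNorm_of_posSemidef hB,
    pNorm_of_posSemidef (hA.kronecker hB), htrace,
    Real.mul_rpow (trace_rpow_nonneg hA p) (trace_rpow_nonneg hB p)]
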